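/- Let $k$ be an algebraically closed field, $m\ge 2$, $R=k[X_0,\dots,X_m]$, and let $f_0,\dots,f_n\in R$ be homogeneous polynomials of the same degree $d$ which form a minimal generating set of the ideal $I=(f_0,\dots,f_n)$ and satisfy $\gcd(f_0,\dots,f_n)=1$. Assume that the rational map $\phi=(f_0:\dots:f_n):\mathbb{P}^m_k\dashrightarrow\mathbb{P}^n_k$ is generically finite onto its image, i.e. that its closed image has dimension $m$. Let $J(\mathbf f)=(\partial f_i/\partial X_j)$ be the Jacobian matrix and $I_3(J(\mathbf f))$ the ideal generated by its $3\times 3$ minors. Assume $I_3(J(\mathbf f))\ne 0$ and let $F$ be the greatest common divisor of the $3\times3$ minors of $J(\mathbf f)$. Let $\Gamma\subset\mathbb{P}^m_k\times\mathbb{P}^n_k$ be the closure of the graph of $\phi$, i.e. the subscheme defined by the Rees algebra $\mathcal R_I=\bigoplus_{s\ge0}I^s$, let $\pi:\Gamma\to\mathbb{P}^n_k$ be the second projection, and for a closed point $y\in\mathbb{P}^n_k$ with residue field $k(y)\cong k$ let $\pi^{-1}(y)=\operatorname{Proj}(\mathcal R_I\otimes_{k[T_0,\dots,T_n]}k(y))\subset\mathbb{P}^m_k$,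 where $T_i$ acts on $\mathcal R_I$ as $f_i$ placed in degree one. Let $\mathcal Y_{m-1}$ be the set of closed points $y$ with $\dim\pi^{-1}(y)=m-1$. Then: 1. $\mathcal Y_{m-1}$ is finite, and for every $y\in\mathcal Y_{m-1}$ the unmixed part of dimension $m-1$ of $\pi^{-1}(y)$ (that is, the intersection of the primary components of maximal dimension of its defining ideal) is defined by one non-zero homogeneous polynomial $h_y\in R$, unique up to a constant factor. 2. If $h_y=\prod_{i=1}^{r_y}h_{y,i}^{e_{y,i}}$ is the factorization of $h_y$ into powers, with exponents $e_{y,i}\ge1$, of pairwise non-associated irreducible polynomials, then $$\sum_{y\in\mathcal Y_{m-1}}\deg h_y\ \le\ \sum_{y\in\mathcal Y_{m-1}}\sum_{i=1}^{r_y}(2e_{y,i}-1)\deg h_{y,i}\ \le\ \deg F\ \le\ 3(d-1).$$ -/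

import Mathlib

open MvPolynomial

noncomputable section

/-- `g` is a greatest common divisor of the elements of `S` (it is unique up to units). -/
def IsGCDOf {R : Type*} [CommRing R] (S : Set R) (g : R) : Prop :=
  (∀ s ∈ S, g ∣ s) ∧ ∀ c : R, (∀ s ∈ S, c ∣ s) → c ∣ g

/-- `h = ∏ i, q i ^ e i` is an irreducible factorization: the `q i` are irreducible and pairwise
non-associated, and the exponents are positive. -/
structure IsIrreducibleFactorization {R : Type*} [CommRing R] {r : ℕ}
    (h : R) (q : Fin r → R) (e : Fin r → ℕ) : Prop where
  irreducible : ∀ i, Irreducible (q i)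
  not_associated : ∀ i j, i ≠ j → ¬ Associated (q i) (q j)
  exponent_pos : ∀ i, 0 < e i
  eq_prod : h = ∏ i, q i ^ e i

/-- No member of the family `f` lies in the ideal generated by the others, that is, `f` is a minimal
generating set of the ideal it generates. -/
def IsMinimalGenerating {R ι : Type*} [CommRing R] (f : ι → R) : Prop :=
  ∀ i, f i ∉ Ideal.span (f '' {j | j ≠ i})

/-- The set of `s`-minors of a matrix. -/
def minorSet {R : Type*} [CommRing R] {a b : ℕ} (s : ℕ) (M : Matrix (Fin a) (Fin b) R) : Set R :=
  Set.range fun rc : (Fin s ↪o Fin a) × (Fin s ↪o Fin b) => (M.submatrix rc.1 rc.2).det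

/-- The ideal `I_s(M)` generated by the `s`-minors of a matrix `M`. -/
def minorIdeal {R : Type*} [CommRing R] {a b : ℕ} (s : ℕ) (M : Matrix (Fin a) (Fin b) R) :
    Ideal R :=
  Ideal.span (minorSet s M)

/-- The unmixed part (of maximal dimension) of an ideal `J`: the intersection of the primary
components of `J` at those primes `P ⊇ J` with `dim R/P = dim R/J`. Such a `P` is a minimal prime of
`J` (when the dimension is finite), and its primary component is the contraction of `J R_P`. -/
def unmixedPart {R : Type*} [CommRing R] (J : Ideal R) : Ideal R :=
  ⨅ P : {P : PrimeSpectrum R //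
      J ≤ P.asIdeal ∧ ringKrullDim (R ⧸ P.asIdeal) = ringKrullDim (R ⧸ J)},
    (J.map (algebraMap R (Localization.AtPrime P.1.asIdeal))).comap
      (algebraMap R (Localization.AtPrime P.1.asIdeal))

attribute [local instance] MvPolynomial.gradedAlgebra

variable {k : Type*} [Field k]

/-- The dimension of the closed subscheme `Proj (k[X_0, …, X_m] / J)` of `ℙ^m` defined by a
homogeneous ideal `J`: the Krull dimension of its underlying topological space
(`⊥` if it is empty). -/
def projDim {m : ℕ} (J : Ideal (MvPolynomial (Fin (m + 1)) k)) : WithBot ℕ∞ :=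
  topologicalKrullDim
    (ProjectiveSpectrum.zeroLocus (homogeneousSubmodule (Fin (m + 1)) k)
      (J : Set (MvPolynomial (Fin (m + 1)) k)))

variable {m n : ℕ} (f : Fin (n + 1) → MvPolynomial (Fin (m + 1)) k)

/-- The Jacobian matrix `(∂ f_i / ∂ X_j)`. -/
def jacobianMatrix : Matrix (Fin (n + 1)) (Fin (m + 1)) (MvPolynomial (Fin (m + 1)) k) :=
  Matrix.of fun i j => pderiv j (f i)

/-- The homogeneous ideal of the closed image of the rational map `ℙ^m ⇢ ℙ^n` defined by `f`: the
kernel of `k[T_0, …, T_n] → k[X_0, …, X_m]`, `T_i ↦ f_i`. -/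
def closedImageIdeal : Ideal (MvPolynomial (Fin (n + 1)) k) :=
  RingHom.ker (aeval f : MvPolynomial (Fin (n + 1)) k →ₐ[k] MvPolynomial (Fin (m + 1)) k)

/-- The rational map defined by `f` is generically finite onto its image, that is, its closed image
has dimension `m`. -/
def IsGenericallyFinite : Prop :=
  projDim (closedImageIdeal f) = (m : WithBot ℕ∞)

/-- With `R = k[X_0, …, X_m]` and `I = (f_0, …, f_n)`, the surjection of `R[T_0, …, T_n]` onto the
Rees algebra `⨁ I^s t^s ⊆ R[t]`, sending `T_i` to `f_i t`. -/
def reesMap : MvPolynomial (Fin (n + 1)) (MvPolynomial (Fin (m + 1)) k) →ₐ[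
    MvPolynomial (Fin (m + 1)) k] Polynomial (MvPolynomial (Fin (m + 1)) k) :=
  aeval fun i => Polynomial.C (f i) * Polynomial.X

/-- The ideal defining the Rees algebra, hence the blow-up `Γ ⊆ ℙ^m × ℙ^n`, which is the closure of
the graph of the rational map. -/
def reesIdeal : Ideal (MvPolynomial (Fin (n + 1)) (MvPolynomial (Fin (m + 1)) k)) :=
  RingHom.ker (reesMap f)

/-- Specialization of the variables `T_i` at the coordinates of `p`. -/
def specialize (p : Fin (n + 1) → k) :
    MvPolynomial (Fin (n + 1)) (MvPolynomial (Fin (m + 1)) k) →+* MvPolynomial (Fin (m + 1)) k :=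
  eval fun i => C (p i)

/-- The ideal of `R = k[X_0, …, X_m]` defining the fiber of the projection `π : Γ → ℙ^n` over the
point with homogeneous coordinates `p`: the Rees algebra tensored over `k[T_0, …, T_n]` with the
residue field `k` is `R` modulo this ideal, so the fiber is `Proj` of that quotient in `ℙ^m`. -/
def fiberIdeal (p : Fin (n + 1) → k) : Ideal (MvPolynomial (Fin (m + 1)) k) :=
  (reesIdeal f).map (specialize p)

/-- The fiber ideal does not depend on the choice of homogeneous coordinates. -/
theorem fiberIdeal_smul (p : Fin (n + 1) → k) {c : k} (hc : c ≠ 0) :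
    fiberIdeal f (c • p) = fiberIdeal f p := by
  have key : ∀ (p : Fin (n + 1) → k) (c : k), fiberIdeal f (c • p) ≤ fiberIdeal f p := by
    intro p c
    refine Ideal.map_le_iff_le_comap.2 fun P hP => ?_
    have hP' : reesMap f P = 0 := hP
    let σ : MvPolynomial (Fin (n + 1)) (MvPolynomial (Fin (m + 1)) k) →ₐ[
        MvPolynomial (Fin (m + 1)) k] MvPolynomial (Fin (n + 1)) (MvPolynomial (Fin (m + 1)) k) :=
      aeval fun i => C (C c) * X i
    let τ : Polynomial (MvPolynomial (Fin (m + 1)) k) →ₐ[MvPolynomial (Fin (m + 1)) k]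
        Polynomial (MvPolynomial (Fin (m + 1)) k) :=
      Polynomial.aeval (Polynomial.C (C c) * Polynomial.X)
    have h1 : (reesMap f).comp σ = τ.comp (reesMap f) := by
      ext i : 1
      simp [σ, τ, reesMap]
      ring
    have h2 : (specialize p).comp σ.toRingHom = specialize (m := m) (c • p) := by
      refine MvPolynomial.ringHom_ext (fun a => ?_) (fun i => ?_) <;> simp [σ, specialize]
    have h3 : σ P ∈ reesIdeal f := by
      have := DFunLike.congr_fun h1 P
      simp only [AlgHom.comp_apply, hP', map_zero] at this
      exact this
    have h4 := Ideal.mem_map_of_mem (specialize p) h3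
    have h5 : specialize p (σ P) = specialize (c • p) P := DFunLike.congr_fun h2 P
    rw [h5] at h4
    exact h4
  refine le_antisymm (key p c) ?_
  have := key (c • p) c⁻¹
  rwa [smul_smul, inv_mul_cancel₀ hc, one_smul] at this

/-- The ideal of the fiber over a closed point `y` of `ℙ^n`. -/
def fiberIdealAt (y : Projectivization k (Fin (n + 1) → k)) :
    Ideal (MvPolynomial (Fin (m + 1)) k) :=
  fiberIdeal f y.rep

/-- The set of closed points of `ℙ^n` whose fiber has dimension `l`. -/
def fiberDimLocus (l : ℕ) : Set (Projectivization k (Fin (n + 1) → k)) :=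
  {y | projDim (fiberIdealAt f y) = (l : WithBot ℕ∞)}

end

/-! Let `p` be coordinates of a point `y`. The fiber ideal contains all `p i * f j - p j * f i`, so
any generator `h` of its unmixed part divides them. If `q ^ e` divides them all, then `f j = p j * u
+ q ^ e * v j` for some `u`, `v`. Differentiating, the Jacobian matrix is a rank-one matrix plus `q
^ (e - 1)` times a matrix of rank at most one modulo `q`. Its 3-minors are therefore divisible by `q
^ (2 * e - 1)` (`pow_dvd_minor`). A prime `q` serves only one `y`: as the gcd is 1, `f` modulo `q`
is non-zero and proportional to `p`, which determines `y` (`eq_of_prime_dvd`). So the powers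
attached to all points and factors are coprime, and their product divides `F`; this bounds the sum,
and taking one prime per point it bounds the number of points.

The unmixed part is principal because primes of dimension `m` containing the fiber ideal have height
one, hence are `(q)`, and the primary component there is `(q ^ e)` with `e` the largest exponent as
above (`fiberIdeal_le_span_pow`). -/

noncomputable section

/-! ### Powers of a prime dividing the 3-minors of the Jacobian matrix -/

section Minors

variable {k : Type*} [Field k] {m n : ℕ} {f : Fin (n + 1) → MvPolynomial (Fin (m + 1)) k}

theorem exists_eq_C_mul_add {p : Fin (n + 1) → k} (hp : p ≠ 0) {g : MvPolynomial (Fin (m + 1)) k}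
    (h : ∀ i j, g ∣ C (p i) * f j - C (p j) * f i) :
    ∃ (i : Fin (n + 1)) (v : Fin (n + 1) → MvPolynomial (Fin (m + 1)) k),
      ∀ j, f j = C (p j) * (C (p i)⁻¹ * f i) + g * v j := by
  obtain ⟨i, hi⟩ := Function.ne_iff.1 hp
  choose w hw using h i
  refine ⟨i, fun j => C (p i)⁻¹ * w j, fun j => ?_⟩
  have h1 : (C (p i)⁻¹ * C (p i) : MvPolynomial (Fin (m + 1)) k) = 1 := by
    rw [← C_mul, inv_mul_cancel₀ hi, C_1]
  linear_combination (-f j) * h1 + C (p i)⁻¹ * hw j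

/-- Expand the determinant by rows: a term using `U` twice or `W` twice vanishes. Each surviving
term thus takes at most one row from `U` and one from `W`, leaving at least two factors `Q` and one
factor `q`. In the witness, `D` is the determinant with the given rows. -/
theorem Matrix.dvd_det_fin_three_of_add {R : Type*} [CommRing R] (A : Matrix (Fin 3) (Fin 3) R)
    (p g : Fin 3 → R) (U W : Fin 3 → R) (V : Fin 3 → Fin 3 → R) (Q q : R)
    (h : ∀ x y, A x y = p x * U y + Q * (q * V x y + g x * W y)) : Q * Q * q ∣ A.det := by
  let D : (Fin 3 → R) → (Fin 3 → R) → (Fin 3 → R) → R := fun a b c =>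
    a 0 * b 1 * c 2 - a 0 * b 2 * c 1 - a 1 * b 0 * c 2 + a 1 * b 2 * c 0 + a 2 * b 0 * c 1
      - a 2 * b 1 * c 0
  refine ⟨p 0 * (q * D U (V 1) (V 2) + g 2 * D U (V 1) W + g 1 * D U W (V 2)) +
    p 1 * (q * D (V 0) U (V 2) + g 2 * D (V 0) U W + g 0 * D W U (V 2)) +
    p 2 * (q * D (V 0) (V 1) U + g 1 * D (V 0) W U + g 0 * D W (V 1) U) +
    Q * q * (q * D (V 0) (V 1) (V 2) + g 0 * D W (V 1) (V 2) + g 1 * D (V 0) W (V 2) +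
      g 2 * D (V 0) (V 1) W), ?_⟩
  rw [Matrix.det_fin_three]
  simp only [h, D]
  ring

theorem pow_dvd_minor {p : Fin (n + 1) → k} (hp : p ≠ 0) {q : MvPolynomial (Fin (m + 1)) k}
    {e : ℕ} (he : 0 < e) (h : ∀ i j, q ^ e ∣ C (p i) * f j - C (p j) * f i)
    {s : MvPolynomial (Fin (m + 1)) k} (hs : s ∈ minorSet 3 (jacobianMatrix f)) :
    q ^ (2 * e - 1) ∣ s := by
  obtain ⟨⟨r, c⟩, rfl⟩ := hs
  obtain ⟨i, v, hv⟩ := exists_eq_C_mul_add hp h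
  -- With `a = e - 1`, the exponent `2 * e - 1` is `a + a + 1`, matching `Q * Q * q` for `Q = q ^
  -- a`.
  obtain ⟨a, rfl⟩ : ∃ a, e = a + 1 := ⟨e - 1, by omega⟩
  generalize C (p i)⁻¹ * f i = u at hv
  have key : ∀ (x : Fin (n + 1)) (y : Fin (m + 1)), jacobianMatrix f x y =
      C (p x) * pderiv y u +
        q ^ a * (q * pderiv y (v x) + v x * (((a + 1 : ℕ) : MvPolynomial (Fin (m + 1)) k) *
          pderiv y q)) := by
    intro x y
    simp only [jacobianMatrix, Matrix.of_apply]
    rw [hv x, map_add, pderiv_C_mul, Derivation.leibniz, Derivation.leibniz_pow]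
    simp only [smul_eq_mul, nsmul_eq_mul, Nat.add_sub_cancel, pow_succ]
    ring
  have e1 : 2 * (a + 1) - 1 = a + a + 1 := by omega
  rw [e1, pow_succ, pow_add]
  exact Matrix.dvd_det_fin_three_of_add _ (fun x => C (p (r x))) (fun x => v (r x))
    (fun y => pderiv (c y) u)
    (fun y => ((a + 1 : ℕ) : MvPolynomial (Fin (m + 1)) k) * pderiv (c y) q)
    (fun x y => pderiv (c y) (v (r x))) _ _ fun x y => key (r x) (c y)

end Minors

/-! ### Divisors of homogeneous polynomials -/

section Homogeneous

variable {σ k : Type*} [Field k]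

/-- The substitution `X i ↦ X i * t`, which separates the homogeneous components. -/
def gradingHom : MvPolynomial σ k →ₐ[k] Polynomial (MvPolynomial σ k) :=
  aeval fun i => Polynomial.C (X i) * Polynomial.X

theorem gradingHom_of_isHomogeneous {a : MvPolynomial σ k} {N : ℕ} (ha : a.IsHomogeneous N) :
    gradingHom a = Polynomial.C a * Polynomial.X ^ N := by
  rw [a.as_sum, map_sum, map_sum, Finset.sum_mul]
  refine Finset.sum_congr rfl fun s hs => ?_
  have h1 : s.degree = N := by
    rw [Finsupp.degree_eq_weight_one]
    exact ha (mem_support_iff.1 hs)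
  rw [gradingHom, aeval_monomial, monomial_eq, map_mul, mul_assoc]
  congr 1
  simp only [mul_pow, Finsupp.prod, Finset.prod_mul_distrib, map_prod, map_pow]
  rw [Finset.prod_pow_eq_pow_sum]
  simp only [← h1, Finsupp.degree_apply]

theorem coeff_gradingHom (a : MvPolynomial σ k) (N : ℕ) :
    (gradingHom a).coeff N = homogeneousComponent N a := by
  conv_lhs => rw [← sum_homogeneousComponent a]
  simp only [map_sum, gradingHom_of_isHomogeneous (homogeneousComponent_isHomogeneous _ a),
    Polynomial.finsetSum_coeff, Polynomial.coeff_C_mul_X_pow]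
  rw [Finset.sum_ite_eq]
  split_ifs with h
  · rfl
  · rw [homogeneousComponent_eq_zero]
    simpa using h

theorem eval_one_gradingHom (a : MvPolynomial σ k) : (gradingHom a).eval 1 = a := by
  have : (Polynomial.evalRingHom (1 : MvPolynomial σ k)).comp gradingHom.toRingHom =
      RingHom.id (MvPolynomial σ k) := by
    refine MvPolynomial.ringHom_ext (fun c => ?_) (fun i => ?_) <;>
      simp [gradingHom, Polynomial.algebraMap_apply, algebraMap_eq]
  exact DFunLike.congr_fun this a

/-- Under `gradingHom` the product becomes a monomial in `t`. Degrees and trailing degrees add over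
a domain, so they coincide for each factor, which is then a monomial in `t` too. -/
theorem MvPolynomial.IsHomogeneous.exists_isHomogeneous_of_dvd {a b : MvPolynomial σ k} {N : ℕ}
    (hb : b.IsHomogeneous N) (hb0 : b ≠ 0) (h : a ∣ b) : ∃ M, a.IsHomogeneous M := by
  obtain ⟨c, rfl⟩ := h
  have inj : ∀ x : MvPolynomial σ k, x ≠ 0 → gradingHom x ≠ 0 := fun x hx h0 => hx <| by
    rw [← eval_one_gradingHom x, h0, Polynomial.eval_zero]
  have ha := inj a (left_ne_zero_of_mul hb0)
  have hc := inj c (right_ne_zero_of_mul hb0)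
  have h1 := gradingHom_of_isHomogeneous hb
  rw [map_mul] at h1
  have h2 := congrArg Polynomial.natDegree h1
  have h3 := congrArg Polynomial.natTrailingDegree h1
  rw [Polynomial.natDegree_mul ha hc, Polynomial.natDegree_C_mul_X_pow _ _ hb0] at h2
  rw [Polynomial.natTrailingDegree_mul ha hc, Polynomial.C_mul_X_pow_eq_monomial,
    Polynomial.natTrailingDegree_monomial hb0] at h3
  have h4 := (gradingHom a).natTrailingDegree_le_natDegree
  have h5 := (gradingHom c).natTrailingDegree_le_natDegree
  refine ⟨(gradingHom a).natDegree, ?_⟩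
  have h6 : a = homogeneousComponent (gradingHom a).natDegree a := by
    conv_lhs => rw [← eval_one_gradingHom a]
    rw [Polynomial.eval_eq_sum_range, Finset.sum_eq_single (gradingHom a).natDegree]
    · simp [-Polynomial.coeff_natDegree, coeff_gradingHom]
    · intro i hi hne
      rw [Polynomial.coeff_eq_zero_of_lt_natTrailingDegree, zero_mul]
      have := Finset.mem_range.1 hi
      omega
    · intro hn
      simp at hn
  generalize (gradingHom a).natDegree = M at h6
  exact h6 ▸ homogeneousComponent_isHomogeneous M a

end Homogeneous

/-! ### Height-one primes, and projective versus affine dimension -/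

section Dimension

/-- A non-zero prime of a UFD contains a prime element `q`. If `P` were larger than `(q)`, killing
`q` and then some `r ∈ P` outside `(q)` would lower the dimension twice, below `m`. -/
theorem exists_prime_span_of_ringKrullDim_quotient {R : Type*} [CommRing R] [IsDomain R]
    [UniqueFactorizationMonoid R] {m : ℕ} (hR : ringKrullDim R = ((m + 1 : ℕ) : WithBot ℕ∞))
    (P : Ideal R) [hP : P.IsPrime] (h0 : P ≠ ⊥)
    (hd : ringKrullDim (R ⧸ P) = (m : WithBot ℕ∞)) : ∃ q, Prime q ∧ P = Ideal.span {q} := by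
  obtain ⟨q, hqP, hq⟩ := hP.exists_mem_prime_of_ne_bot h0
  refine ⟨q, hq, le_antisymm (fun r hr => ?_) ((Ideal.span_singleton_le_iff_mem _).2 hqP)⟩
  by_contra hrq
  have hqp : (Ideal.span {q}).IsPrime := (Ideal.span_singleton_prime hq.ne_zero).2 hq
  have h1 := ringKrullDim_quotient_succ_le_of_nonZeroDivisor
    (mem_nonZeroDivisors_of_ne_zero hq.ne_zero)
  have h2 := ringKrullDim_quotient_succ_le_of_nonZeroDivisor
    (r := Ideal.Quotient.mk (Ideal.span {q}) r)
    (mem_nonZeroDivisors_of_ne_zero (by rwa [Ne, Ideal.Quotient.eq_zero_iff_mem]))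
  let φ : (R ⧸ Ideal.span {q}) ⧸ Ideal.span {Ideal.Quotient.mk (Ideal.span {q}) r} →+* R ⧸ P :=
    Ideal.Quotient.lift _
      (Ideal.Quotient.factor ((Ideal.span_singleton_le_iff_mem _).2 hqP)) (by
        intro a ha
        obtain ⟨b, rfl⟩ := Ideal.mem_span_singleton'.1 ha
        rw [map_mul, Ideal.Quotient.factor_mk, Ideal.Quotient.eq_zero_iff_mem.2 hr, mul_zero])
  have hφ : Function.Surjective φ := by
    intro x
    obtain ⟨x, rfl⟩ := Ideal.Quotient.mk_surjective x
    exact ⟨Ideal.Quotient.mk _ (Ideal.Quotient.mk _ x), by simp [φ]⟩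
  have h3 := ringKrullDim_le_of_surjective φ hφ
  rw [hd] at h3
  have h4 : ((m + 1 + 1 : ℕ) : WithBot ℕ∞) ≤ ((m + 1 : ℕ) : WithBot ℕ∞) := by
    rw [← hR]
    refine le_trans ?_ h1
    push_cast
    gcongr
    refine le_trans ?_ h2
    gcongr
  have := Nat.cast_le.1 h4
  omega

attribute [local instance] MvPolynomial.gradedAlgebra

variable {k : Type*} [Field k] {m : ℕ}

theorem vanishingIdeal_isPrime_of_isIrreducible {A : Type*} [CommRing A] {σ : Type*}
    [SetLike σ A] [AddSubmonoidClass σ A] (𝒜 : ℕ → σ) [GradedRing 𝒜]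
    {T : Set (ProjectiveSpectrum 𝒜)} (hT : IsIrreducible T) :
    (ProjectiveSpectrum.vanishingIdeal T).toIdeal.IsPrime := by
  refine ⟨fun h => ?_, fun {a b} hab => ?_⟩
  · obtain ⟨x, hx⟩ := hT.nonempty
    refine x.isPrime.ne_top ((Ideal.eq_top_iff_one _).2 ?_)
    have h1 : (1 : A) ∈ ProjectiveSpectrum.vanishingIdeal T := by
      rw [← HomogeneousIdeal.mem_iff, h]; trivial
    exact (ProjectiveSpectrum.mem_vanishingIdeal _ _).1 h1 x hx
  · rw [HomogeneousIdeal.mem_iff, ProjectiveSpectrum.mem_vanishingIdeal] at hab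
    have h1 := isPreirreducible_iff_isClosed_union_isClosed.1 hT.isPreirreducible
      (ProjectiveSpectrum.zeroLocus 𝒜 {a}) (ProjectiveSpectrum.zeroLocus 𝒜 {b})
      (ProjectiveSpectrum.isClosed_zeroLocus _ _) (ProjectiveSpectrum.isClosed_zeroLocus _ _)
      (fun x hx => by simpa using x.isPrime.mem_or_mem (hab x hx))
    rw [HomogeneousIdeal.mem_iff, HomogeneousIdeal.mem_iff,
      ProjectiveSpectrum.mem_vanishingIdeal, ProjectiveSpectrum.mem_vanishingIdeal]
    exact h1.imp (fun h x hx => by simpa using h hx) (fun h x hx => by simpa using h hx)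

theorem MvPolynomial.constantCoeff_eq_zero_of_mem_homogeneousIdeal {σ : Type*}
    (P : HomogeneousIdeal (homogeneousSubmodule σ k)) (hP : P.toIdeal ≠ ⊤)
    {a : MvPolynomial σ k} (ha : a ∈ P) : constantCoeff a = 0 := by
  by_contra h
  refine hP (Ideal.eq_top_of_isUnit_mem _ (x := C (constantCoeff a)) ?_
    ((isUnit_iff_ne_zero.2 h).map C))
  have h1 := P.isHomogeneous 0 ha
  erw [decomposition.decompose'_apply, homogeneousComponent_zero] at h1
  exact h1

theorem MvPolynomial.ker_constantCoeff_eq_irrelevant {σ : Type*} :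
    RingHom.ker (constantCoeff (R := k) (σ := σ)) =
      (HomogeneousIdeal.irrelevant (homogeneousSubmodule σ k)).toIdeal := by
  ext a
  rw [RingHom.mem_ker, HomogeneousIdeal.mem_iff, HomogeneousIdeal.mem_irrelevant_iff,
    GradedRing.proj_apply]
  erw [decomposition.decompose'_apply]
  rw [homogeneousComponent_zero, C_eq_zero]
  rfl

/-- A chain of irreducible closed sets gives a reversed chain of homogeneous primes containing `J`.
All are strictly inside the irrelevant ideal, which extends the chain by one. -/
theorem succ_le_ringKrullDim_quotient_of_projDim {J : Ideal (MvPolynomial (Fin (m + 1)) k)} {l : ℕ}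
    (hJ : projDim J = (l : WithBot ℕ∞)) :
    ((l + 1 : ℕ) : WithBot ℕ∞) ≤ ringKrullDim (MvPolynomial (Fin (m + 1)) k ⧸ J) := by
  set 𝒜 := homogeneousSubmodule (Fin (m + 1)) k
  set Z := ProjectiveSpectrum.zeroLocus 𝒜 (J : Set (MvPolynomial (Fin (m + 1)) k))
  obtain ⟨c, hc⟩ := Order.le_krullDim_iff.1 (hJ.ge : _ ≤ Order.krullDim
    (TopologicalSpace.IrreducibleCloseds Z))
  let T : TopologicalSpace.IrreducibleCloseds Z → Set (ProjectiveSpectrum 𝒜) :=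
    fun W => Subtype.val '' (W : Set Z)
  have hT : ∀ W, IsIrreducible (T W) := fun W =>
    W.isIrreducible.image _ continuous_subtype_val.continuousOn
  have hprime := fun W => vanishingIdeal_isPrime_of_isIrreducible 𝒜 (hT W)
  have hJle : ∀ W, J ≤ (ProjectiveSpectrum.vanishingIdeal (T W)).toIdeal := fun W a ha => by
    rw [HomogeneousIdeal.mem_iff, ProjectiveSpectrum.mem_vanishingIdeal]
    rintro _ ⟨x, -, rfl⟩
    exact x.2 ha
  let M : Ideal (MvPolynomial (Fin (m + 1)) k) := RingHom.ker constantCoeff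
  have hM : ∀ W, (ProjectiveSpectrum.vanishingIdeal (T W)).toIdeal < M := fun W => by
    refine lt_of_le_not_ge (fun a ha => constantCoeff_eq_zero_of_mem_homogeneousIdeal _
      (hprime W).ne_top ha) fun hle => ?_
    obtain ⟨x, hx⟩ := (hT W).nonempty
    refine x.not_irrelevant_le fun a ha => ?_
    have h1 : a ∈ M := by
      change a ∈ RingHom.ker _
      rw [ker_constantCoeff_eq_irrelevant]
      exact ha
    exact (ProjectiveSpectrum.mem_vanishingIdeal _ _).1 (hle h1) x hx
  let g : TopologicalSpace.IrreducibleCloseds Z →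
      (PrimeSpectrum.zeroLocus (J : Set (MvPolynomial (Fin (m + 1)) k)))ᵒᵈ :=
    fun W => OrderDual.toDual ⟨⟨_, hprime W⟩, hJle W⟩
  have hg : StrictMono g := by
    intro W W' hW
    have hle : (ProjectiveSpectrum.vanishingIdeal (T W')).toIdeal ≤
        (ProjectiveSpectrum.vanishingIdeal (T W)).toIdeal := by
      have h := ProjectiveSpectrum.vanishingIdeal_anti_mono 𝒜 (Set.image_mono hW.le :
        T W ⊆ T W')
      exact h
    refine lt_of_le_not_ge hle fun hge => hW.not_ge fun x hx => ?_
    have h1 : (x : ProjectiveSpectrum 𝒜) ∈ closure (T W) := by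
      rw [← ProjectiveSpectrum.zeroLocus_vanishingIdeal_eq_closure]
      intro a ha
      exact (ProjectiveSpectrum.mem_vanishingIdeal _ _).1 (hge ha) x ⟨x, hx, rfl⟩
    have h2 : x ∈ closure (W : Set Z) := closure_subtype.2 h1
    rwa [W.isClosed.closure_eq] at h2
  have hMp : M.IsPrime := RingHom.ker_isPrime _
  let M' : (PrimeSpectrum.zeroLocus (J : Set (MvPolynomial (Fin (m + 1)) k)))ᵒᵈ :=
    OrderDual.toDual ⟨⟨M, hMp⟩, (hJle c.head).trans (hM _).le⟩
  rw [ringKrullDim_quotient, ← Order.krullDim_orderDual]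
  refine Order.le_krullDim_iff.2 ⟨(c.map g hg).cons M' (hM c.head), ?_⟩
  change 0 + c.length + 1 = l + 1
  omega

end Dimension

/-! ### The fiber ideal -/

section Fiber

variable {k : Type*} [Field k] {m n : ℕ} {f : Fin (n + 1) → MvPolynomial (Fin (m + 1)) k}

theorem IsGCDOf.exists_not_dvd_of_prime {ι R : Type*} [CommRing R] {f : ι → R}
    (hf : IsGCDOf (Set.range f) 1) {q : R} (hq : Prime q) : ∃ i, ¬ q ∣ f i := by
  by_contra! h
  exact hq.not_isUnit (isUnit_of_dvd_one (hf.2 q (by rintro _ ⟨i, rfl⟩; exact h i)))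

theorem mul_sub_mul_mem_fiberIdeal (p : Fin (n + 1) → k) (i j : Fin (n + 1)) :
    C (p i) * f j - C (p j) * f i ∈ fiberIdeal f p := by
  have h : X i * C (f j) - X j * C (f i) ∈ reesIdeal f := by
    rw [reesIdeal, RingHom.mem_ker]
    simp only [reesMap, map_sub, map_mul, aeval_X, algHom_C, Polynomial.algebraMap_apply,
      Algebra.algebraMap_self, RingHom.id_apply]
    ring
  simpa [specialize, fiberIdeal] using Ideal.mem_map_of_mem (specialize p) h

/-- Modulo `q ^ e`, `f` equals `p * u` with `u` prime to `q`. A relation `P(f t) = 0` becomes `P(p u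
t) = 0`; its coefficients are those of `P(p t)` times powers of the non-zero-divisor `u`, so `P(p t)
= 0`, and `t = 1` gives the claim. -/
theorem fiberIdeal_le_span_pow {p : Fin (n + 1) → k} (hp : p ≠ 0)
    {q : MvPolynomial (Fin (m + 1)) k} (hq : Prime q) (hf : ∃ i, ¬ q ∣ f i) {e : ℕ} (he : 0 < e)
    (h : ∀ i j, q ^ e ∣ C (p i) * f j - C (p j) * f i) :
    fiberIdeal f p ≤ Ideal.span {q ^ e} := by
  obtain ⟨i, v, hv⟩ := exists_eq_C_mul_add hp h
  generalize C (p i)⁻¹ * f i = u at hv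
  have hu : ¬ q ∣ u := fun hu => by
    obtain ⟨j, hj⟩ := hf
    rw [hv j] at hj
    exact hj (dvd_add (hu.mul_left _) ((dvd_pow_self q he.ne').mul_right _))
  set π := Ideal.Quotient.mk (Ideal.span {q ^ e})
  have hπ : π (q ^ e) = 0 := Ideal.Quotient.eq_zero_iff_mem.2 (Ideal.mem_span_singleton_self _)
  -- `G` sends `P` to `P(p t)` with coefficients modulo `q ^ e`.
  let G : MvPolynomial (Fin (n + 1)) (MvPolynomial (Fin (m + 1)) k) →+*
      Polynomial (MvPolynomial (Fin (m + 1)) k ⧸ Ideal.span {q ^ e}) :=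
    eval₂Hom (Polynomial.C.comp π) fun j => Polynomial.C (π (C (p j))) * Polynomial.X
  have h1 : (Polynomial.compRingHom (Polynomial.C (π u) * Polynomial.X)).comp G =
      (Polynomial.mapRingHom π).comp (reesMap f).toRingHom := by
    refine MvPolynomial.ringHom_ext (fun a => ?_) (fun j => ?_)
    · simp [G, reesMap]
    · have : π (f j) = π (C (p j)) * π u := by
        rw [hv j, map_add, map_mul, map_mul, hπ, zero_mul, add_zero]
      simp [G, reesMap, this, mul_assoc]
  have h2 : (Polynomial.evalRingHom 1).comp G = π.comp (specialize p) := by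
    refine MvPolynomial.ringHom_ext (fun a => ?_) (fun j => ?_) <;> simp [G, specialize]
  refine Ideal.map_le_iff_le_comap.2 fun P hP => ?_
  have h3 : (G P).comp (Polynomial.C (π u) * Polynomial.X) = 0 := by
    have h4 := DFunLike.congr_fun h1 P
    have h5 : (reesMap f).toRingHom P = 0 := hP
    rwa [RingHom.comp_apply, RingHom.comp_apply, h5, map_zero] at h4
  have h6 : G P = 0 := by
    ext s
    have h7 := congrArg (fun g => Polynomial.coeff g s) h3
    simp only [Polynomial.comp_C_mul_X_coeff, Polynomial.coeff_zero] at h7 ⊢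
    obtain ⟨x, hx⟩ := Ideal.Quotient.mk_surjective ((G P).coeff s)
    rw [← hx, ← map_pow, ← map_mul, Ideal.Quotient.eq_zero_iff_mem,
      Ideal.mem_span_singleton] at h7
    rw [← hx, Ideal.Quotient.eq_zero_iff_mem, Ideal.mem_span_singleton]
    exact hq.pow_dvd_of_dvd_mul_right e (fun hd => hu (hq.dvd_of_dvd_pow hd)) h7
  have h8 := DFunLike.congr_fun h2 P
  rw [RingHom.comp_apply, h6, map_zero] at h8
  change specialize p P ∈ Ideal.span {q ^ e}
  exact Ideal.Quotient.eq_zero_iff_mem.1 h8.symm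

end Fiber

/-! ### The unmixed part is principal -/

section UnmixedPart

theorem le_unmixedPart {R : Type*} [CommRing R] (J : Ideal R) : J ≤ unmixedPart J :=
  le_iInf fun _ => Ideal.le_comap_map

/-- The element `a` is `q ^ e` times some `b ∉ P`. Since `b` is a unit in the localization, `q ^ e`
lies in the extension of `J`. -/
theorem comap_map_localization_eq_span_pow {R : Type*} [CommRing R] [IsDomain R] {J P : Ideal R}
    [P.IsPrime] {q : R} (hq : Prime q) (hP : P = Ideal.span {q}) {e : ℕ}
    (hJ : J ≤ Ideal.span {q ^ e}) {a : R} (ha : a ∈ J) (hae : ¬ q ^ (e + 1) ∣ a) :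
    (J.map (algebraMap R (Localization.AtPrime P))).comap
      (algebraMap R (Localization.AtPrime P)) = Ideal.span {q ^ e} := by
  have hmem : ∀ x, x ∈ P.primeCompl ↔ ¬ q ∣ x := fun x => by
    rw [Ideal.mem_primeCompl_iff, hP, Ideal.mem_span_singleton]
  ext x
  rw [Ideal.mem_comap, IsLocalization.algebraMap_mem_map_algebraMap_iff P.primeCompl,
    Ideal.mem_span_singleton]
  constructor
  · rintro ⟨s, hs, hsx⟩
    exact hq.pow_dvd_of_dvd_mul_left e ((hmem s).1 hs) (Ideal.mem_span_singleton.1 (hJ hsx))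
  · rintro ⟨y, rfl⟩
    obtain ⟨b, rfl⟩ := Ideal.mem_span_singleton.1 (hJ ha)
    refine ⟨b, (hmem b).2 fun hb => hae ?_, ?_⟩
    · rw [pow_succ]
      exact mul_dvd_mul_left _ hb
    · rw [show b * (q ^ e * y) = y * (q ^ e * b) by ring]
      exact J.mul_mem_left y ha

theorem exists_ringKrullDim_quotient_prime_eq {R : Type*} [CommRing R] {J : Ideal R} {m : ℕ}
    (hd : ringKrullDim (R ⧸ J) = (m : WithBot ℕ∞)) :
    ∃ P : PrimeSpectrum R, J ≤ P.asIdeal ∧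
      ringKrullDim (R ⧸ P.asIdeal) = (m : WithBot ℕ∞) := by
  obtain ⟨c, hc⟩ := Order.le_krullDim_iff.1 ((ringKrullDim_quotient J).symm.trans hd).ge
  have hJ : J ≤ c.head.1.asIdeal := c.head.2
  refine ⟨c.head.1, hJ, le_antisymm ?_ ?_⟩
  · exact hd ▸ ringKrullDim_le_of_surjective _ (Ideal.Quotient.factor_surjective hJ)
  · rw [ringKrullDim_quotient]
    refine Order.le_krullDim_iff.2 ⟨⟨c.length, fun i => ⟨(c i).1, ?_⟩, fun i => c.step i⟩, hc⟩
    exact c.monotone (Fin.zero_le i)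

theorem IsRelPrime.of_prime_of_span_ne {R : Type*} [CommRing R] [IsDomain R] {p q : R}
    (hp : Prime p) (hq : Prime q) (h : Ideal.span {p} ≠ Ideal.span {q}) : IsRelPrime p q :=
  hp.irreducible.isRelPrime_iff_not_dvd.2 fun hd =>
    h (Ideal.span_singleton_eq_span_singleton.2 (hp.associated_of_dvd hq hd))

variable {k : Type*} [Field k] {m n : ℕ} {f : Fin (n + 1) → MvPolynomial (Fin (m + 1)) k}

theorem ringKrullDim_mvPolynomial_fin :
    ringKrullDim (MvPolynomial (Fin (m + 1)) k) = ((m + 1 : ℕ) : WithBot ℕ∞) := by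
  rw [MvPolynomial.ringKrullDim_of_isNoetherianRing, ringKrullDim_eq_zero_of_field]
  simp

theorem ringKrullDim_quotient_eq_of_projDim (hm : 0 < m)
    {J : Ideal (MvPolynomial (Fin (m + 1)) k)} (hJ0 : J ≠ ⊥)
    (hJ : projDim J = ((m - 1 : ℕ) : WithBot ℕ∞)) :
    ringKrullDim (MvPolynomial (Fin (m + 1)) k ⧸ J) = (m : WithBot ℕ∞) := by
  refine le_antisymm ?_ ?_
  · obtain ⟨a, haJ, ha0⟩ := Submodule.exists_mem_ne_zero_of_ne_bot hJ0
    have h1 := ringKrullDim_quotient_succ_le_of_nonZeroDivisor (mem_nonZeroDivisors_of_ne_zero ha0)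
    have h2 := ringKrullDim_le_of_surjective _
      (Ideal.Quotient.factor_surjective ((Ideal.span_singleton_le_iff_mem _).2 haJ))
    rw [ringKrullDim_mvPolynomial_fin] at h1
    have h3 := (add_le_add h2 le_rfl).trans h1
    push_cast at h3
    exact ENat.WithBot.add_le_add_one_right_iff.1 h3
  · have := succ_le_ringKrullDim_quotient_of_projDim hJ
    rwa [Nat.sub_add_cancel hm] at this

theorem exists_unmixedPart_fiberIdeal_eq_span {p : Fin (n + 1) → k} (hp : p ≠ 0)
    (hgcd : IsGCDOf (Set.range f) 1) (hne : ∃ i j, C (p i) * f j - C (p j) * f i ≠ 0)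
    (hd : ringKrullDim (MvPolynomial (Fin (m + 1)) k ⧸ fiberIdeal f p) = (m : WithBot ℕ∞)) :
    ∃ h, h ≠ 0 ∧ ¬ IsUnit h ∧ unmixedPart (fiberIdeal f p) = Ideal.span {h} := by
  classical
  set J := fiberIdeal f p
  obtain ⟨i₀, j₀, ha0⟩ := hne
  have haJ : C (p i₀) * f j₀ - C (p j₀) * f i₀ ∈ J := mul_sub_mul_mem_fiberIdeal p i₀ j₀
  set a := C (p i₀) * f j₀ - C (p j₀) * f i₀ with hadef
  let S := {P : PrimeSpectrum (MvPolynomial (Fin (m + 1)) k) // J ≤ P.asIdeal ∧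
    ringKrullDim (MvPolynomial (Fin (m + 1)) k ⧸ P.asIdeal) =
      ringKrullDim (MvPolynomial (Fin (m + 1)) k ⧸ J)}
  have hbot : ∀ Q : Ideal (MvPolynomial (Fin (m + 1)) k), J ≤ Q → Q ≠ ⊥ := fun Q hQ h0 =>
    ha0 (by simpa [h0] using hQ haJ)
  have hprin : ∀ P : S, ∃ q, Prime q ∧ P.1.asIdeal = Ideal.span {q} := fun P =>
    exists_prime_span_of_ringKrullDim_quotient ringKrullDim_mvPolynomial_fin P.1.asIdeal
      (hbot _ P.2.1) (P.2.2.trans hd)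
  choose q hq hPq using hprin
  have hexp : ∀ P : S, ∃ e, 0 < e ∧ (J.map (algebraMap _ (Localization.AtPrime P.1.asIdeal))).comap
      (algebraMap _ (Localization.AtPrime P.1.asIdeal)) = Ideal.span {q P ^ e} := by
    intro P
    -- The exponent is one less than the first `N` for which `q ^ N` fails to divide some `p i * f j
    -- - p j * f i`. It is positive because `J ≤ P = (q)`.
    have hex : ∃ N, ∃ i j, ¬ q P ^ N ∣ C (p i) * f j - C (p j) * f i := by
      obtain ⟨N, hN⟩ := FiniteMultiplicity.of_prime_left (hq P) ha0
      exact ⟨N + 1, i₀, j₀, hN⟩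
    have hlt : 1 < Nat.find hex := by
      rw [Nat.lt_find_iff]
      intro N hN
      push Not
      intro i j
      refine (pow_dvd_pow _ hN).trans ?_
      rw [pow_one, ← Ideal.mem_span_singleton, ← hPq P]
      exact P.2.1 (mul_sub_mul_mem_fiberIdeal p i j)
    obtain ⟨i, j, hij⟩ := Nat.find_spec hex
    have hmin : ∀ i j, q P ^ (Nat.find hex - 1) ∣ C (p i) * f j - C (p j) * f i := by
      have := Nat.find_min hex (m := Nat.find hex - 1) (by omega)
      push Not at this
      exact this
    refine ⟨Nat.find hex - 1, by omega, comap_map_localization_eq_span_pow (hq P) (hPq P)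
      (fiberIdeal_le_span_pow hp (hq P) (hgcd.exists_not_dvd_of_prime (hq P)) (by omega) hmin)
      (mul_sub_mul_mem_fiberIdeal p i j) ?_⟩
    rwa [Nat.sub_add_cancel (by omega)]
  choose e he hloc using hexp
  -- The primes in `S` are minimal over `J`: a smaller prime over `J` is non-zero, so it contains a
  -- prime element, necessarily associated to `q P`.
  have hfin : Finite S := by
    have hmem : ∀ P : S, P.1.asIdeal ∈ J.minimalPrimes := fun P => by
      refine ⟨⟨P.1.isPrime, P.2.1⟩, fun Q hQ hle => ?_⟩
      have := hQ.1
      obtain ⟨b, hbQ, hb⟩ := hQ.1.exists_mem_prime_of_ne_bot (hbot Q hQ.2)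
      have h1 : q P ∣ b := by
        rw [← Ideal.mem_span_singleton, ← hPq P]
        exact hle hbQ
      rw [hPq P, Ideal.span_singleton_eq_span_singleton.2 ((hq P).associated_of_dvd hb h1)]
      exact (Ideal.span_singleton_le_iff_mem _).2 hbQ
    have := (Ideal.finite_minimalPrimes_of_isNoetherianRing _ J).to_subtype
    refine Finite.of_injective (fun P : S => (⟨_, hmem P⟩ : J.minimalPrimes)) fun P P' h => ?_
    exact Subtype.ext (PrimeSpectrum.ext (congrArg Subtype.val h))
  have := Fintype.ofFinite S
  have hrel : Pairwise (Function.onFun IsRelPrime fun P : S => q P ^ e P) := fun P P' hne =>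
    IsRelPrime.pow (IsRelPrime.of_prime_of_span_ne (hq P) (hq P') fun h =>
      hne (Subtype.ext (PrimeSpectrum.ext (by rw [hPq P, hPq P', h]))))
  refine ⟨∏ P : S, q P ^ e P, ?_, ?_, ?_⟩
  · exact Finset.prod_ne_zero_iff.2 fun P _ => pow_ne_zero _ (hq P).ne_zero
  · obtain ⟨P⟩ : Nonempty S := by
      obtain ⟨P, hP⟩ := exists_ringKrullDim_quotient_prime_eq hd
      exact ⟨P, hP.1, hP.2.trans hd.symm⟩
    intro hu
    exact (hq P).not_isUnit (isUnit_of_dvd_unit ((dvd_pow_self _ (he P).ne').trans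
      (Finset.dvd_prod_of_mem (fun P => q P ^ e P) (Finset.mem_univ P))) hu)
  · ext x
    rw [unmixedPart, Ideal.mem_iInf, Ideal.mem_span_singleton]
    simp only [hloc, Ideal.mem_span_singleton]
    exact ⟨fun h => Fintype.prod_dvd_of_isRelPrime hrel h, fun h P =>
      (Finset.dvd_prod_of_mem (fun P => q P ^ e P) (Finset.mem_univ P)).trans h⟩

end UnmixedPart

/-! ### Total degrees of products and divisors -/

section Degree

variable {σ k : Type*} [Field k]

theorem MvPolynomial.totalDegree_prod_of_ne_zero {ι : Type*} (s : Finset ι)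
    (g : ι → MvPolynomial σ k) (h : ∀ i ∈ s, g i ≠ 0) :
    (∏ i ∈ s, g i).totalDegree = ∑ i ∈ s, (g i).totalDegree := by
  classical
  induction s using Finset.induction_on with
  | empty => simp
  | insert a s ha ih =>
    rw [Finset.prod_insert ha, Finset.sum_insert ha, totalDegree_mul_of_isDomain
      (h a (Finset.mem_insert_self a s))
      (Finset.prod_ne_zero_iff.2 fun i hi => h i (Finset.mem_insert_of_mem hi)),
      ih fun i hi => h i (Finset.mem_insert_of_mem hi)]

theorem MvPolynomial.totalDegree_pow_of_ne_zero {a : MvPolynomial σ k} (ha : a ≠ 0) (N : ℕ) :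
    (a ^ N).totalDegree = N * a.totalDegree := by
  simpa using totalDegree_prod_of_ne_zero (Finset.range N) (fun _ => a) fun _ _ => ha

theorem MvPolynomial.totalDegree_le_of_dvd {a b : MvPolynomial σ k} (hb : b ≠ 0) (h : a ∣ b) :
    a.totalDegree ≤ b.totalDegree := by
  obtain ⟨c, rfl⟩ := h
  rw [totalDegree_mul_of_isDomain (left_ne_zero_of_mul hb) (right_ne_zero_of_mul hb)]
  exact Nat.le_add_right _ _

theorem MvPolynomial.totalDegree_pos_of_prime {q : MvPolynomial σ k} (hq : Prime q) :
    0 < q.totalDegree := by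
  refine Nat.pos_of_ne_zero fun h => hq.not_isUnit ?_
  rw [totalDegree_eq_zero_iff_eq_C.1 h]
  refine (isUnit_iff_ne_zero.2 fun h0 => hq.ne_zero ?_).map C
  rw [totalDegree_eq_zero_iff_eq_C.1 h, h0, C_0]

theorem MvPolynomial.eq_zero_of_prime_dvd_C {q : MvPolynomial σ k} (hq : Prime q) {c : k}
    (h : q ∣ C c) : c = 0 := by
  by_contra hc
  exact hq.not_isUnit (isUnit_of_dvd_unit h ((isUnit_iff_ne_zero.2 hc).map C))

end Degree

/-! ### Separation of points by primes, and the degree bound -/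

section Main

variable {k : Type*} [Field k] {m n : ℕ} {f : Fin (n + 1) → MvPolynomial (Fin (m + 1)) k}

theorem coord_ne_zero_of_prime_dvd {p : Fin (n + 1) → k} (hp : p ≠ 0)
    {q : MvPolynomial (Fin (m + 1)) k} (hq : Prime q)
    (h : ∀ i j, q ∣ C (p i) * f j - C (p j) * f i) {l : Fin (n + 1)} (hl : ¬ q ∣ f l) :
    p l ≠ 0 := fun h0 => hp <| funext fun i => by
  have h1 := h i l
  rw [h0, C_0, zero_mul, sub_zero] at h1
  exact eq_zero_of_prime_dvd_C hq ((hq.dvd_or_dvd h1).resolve_right hl)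

theorem eq_of_prime_dvd {y y' : Projectivization k (Fin (n + 1) → k)}
    {q : MvPolynomial (Fin (m + 1)) k} (hq : Prime q) (hf : ∃ i, ¬ q ∣ f i)
    (h : ∀ i j, q ∣ C (y.rep i) * f j - C (y.rep j) * f i)
    (h' : ∀ i j, q ∣ C (y'.rep i) * f j - C (y'.rep j) * f i) : y = y' := by
  obtain ⟨l, hl⟩ := hf
  have h0 := coord_ne_zero_of_prime_dvd y'.rep_nonzero hq h' hl
  rw [← y.mk_rep, ← y'.mk_rep, Projectivization.mk_eq_mk_iff']
  refine ⟨y.rep l / y'.rep l, funext fun i => ?_⟩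
  have h1 : q ∣ C (y.rep i * y'.rep l - y'.rep i * y.rep l) * f l := by
    convert dvd_sub ((h i l).mul_left (C (y'.rep l))) ((h' i l).mul_left (C (y.rep l))) using 1
    simp only [C_sub, C_mul]
    ring
  have h2 := eq_zero_of_prime_dvd_C hq ((hq.dvd_or_dvd h1).resolve_right hl)
  rw [Pi.smul_apply, smul_eq_mul]
  field_simp
  linear_combination -h2

/-- Stated for any finite set of points and any prime powers dividing the `p a * f b - p b * f a`,
so that it yields both the finiteness of the locus and the final inequality. -/
theorem sum_totalDegree_le_of_isGCDOf (hgcd : IsGCDOf (Set.range f) 1)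
    {F : MvPolynomial (Fin (m + 1)) k} (hF : IsGCDOf (minorSet 3 (jacobianMatrix f)) F)
    (hF0 : F ≠ 0) (T : Finset (Projectivization k (Fin (n + 1) → k)))
    (r : Projectivization k (Fin (n + 1) → k) → ℕ)
    (q : ∀ y, Fin (r y) → MvPolynomial (Fin (m + 1)) k) (e : ∀ y, Fin (r y) → ℕ)
    (hq : ∀ y ∈ T, ∀ i, Prime (q y i))
    (hna : ∀ y ∈ T, ∀ i j, i ≠ j → ¬ Associated (q y i) (q y j))
    (he : ∀ y ∈ T, ∀ i, 0 < e y i)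
    (hd : ∀ y ∈ T, ∀ i a b, q y i ^ e y i ∣ C (y.rep a) * f b - C (y.rep b) * f a) :
    ∑ y ∈ T, ∑ i, (2 * e y i - 1) * (q y i).totalDegree ≤ F.totalDegree := by
  have hqd : ∀ y ∈ T, ∀ i a b, q y i ∣ C (y.rep a) * f b - C (y.rep b) * f a :=
    fun y hy i a b => (dvd_pow_self _ (he y hy i).ne').trans (hd y hy i a b)
  have hne : ∀ x ∈ T.sigma fun y => (Finset.univ : Finset (Fin (r y))),
      q x.1 x.2 ^ (2 * e x.1 x.2 - 1) ≠ 0 := fun x hx =>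
    pow_ne_zero _ (hq x.1 (Finset.mem_sigma.1 hx).1 x.2).ne_zero
  have hdvd : ∏ x ∈ T.sigma fun y => (Finset.univ : Finset (Fin (r y))),
      q x.1 x.2 ^ (2 * e x.1 x.2 - 1) ∣ F := by
    refine Finset.prod_dvd_of_isRelPrime ?_ fun x hx => ?_
    · rintro ⟨y, i⟩ hx ⟨y', i'⟩ hx' hxx
      have hy := (Finset.mem_sigma.1 hx).1
      have hy' := (Finset.mem_sigma.1 hx').1
      refine IsRelPrime.pow ((hq y hy i).irreducible.isRelPrime_iff_not_dvd.2 fun hdv => ?_)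
      have hass : Associated (q y i) (q y' i') := (hq y hy i).associated_of_dvd (hq y' hy' i') hdv
      obtain rfl : y = y' := eq_of_prime_dvd (hq y hy i)
        (hgcd.exists_not_dvd_of_prime (hq y hy i)) (hqd y hy i)
        fun a b => hdv.trans (hqd y' hy' i' a b)
      exact hna y hy i i' (fun hii => hxx (by rw [hii])) hass
    · have hy := (Finset.mem_sigma.1 hx).1
      exact hF.2 _ fun s hs => pow_dvd_minor x.1.rep_nonzero (he _ hy _) (hd _ hy _) hs
  have h1 := totalDegree_le_of_dvd hF0 hdvd
  rw [totalDegree_prod_of_ne_zero _ _ hne, Finset.sum_sigma] at h1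
  refine le_trans (le_of_eq ?_) h1
  exact Finset.sum_congr rfl fun y hy => Finset.sum_congr rfl fun i _ =>
    (totalDegree_pow_of_ne_zero (hq y hy i).ne_zero _).symm

theorem isHomogeneous_of_mem_minorSet_three {d : ℕ} (hhom : ∀ i, (f i).IsHomogeneous d)
    {s : MvPolynomial (Fin (m + 1)) k} (hs : s ∈ minorSet 3 (jacobianMatrix f)) :
    s.IsHomogeneous (3 * (d - 1)) := by
  obtain ⟨⟨r, c⟩, rfl⟩ := hs
  change ((jacobianMatrix f).submatrix r c).det.IsHomogeneous _
  rw [Matrix.det_apply]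
  refine IsHomogeneous.sum _ _ _ fun τ _ => ?_
  have h1 := IsHomogeneous.prod Finset.univ
    (fun i => (jacobianMatrix f).submatrix r c (τ i) i) (fun _ => d - 1)
    fun i _ => (hhom (r (τ i))).pderiv (i := c i)
  rw [Finset.sum_const, Finset.card_univ, Fintype.card_fin, smul_eq_mul] at h1
  rw [Units.smul_def, ← Int.cast_smul_eq_zsmul k]
  exact (homogeneousSubmodule (Fin (m + 1)) k _).smul_mem _ h1

/-- If all of these vanished, every `f j` would be a multiple of a single `f i`, contradicting
minimality for `j ≠ i`. -/
theorem exists_mul_sub_mul_ne_zero (hn : 0 < n) (hmin : IsMinimalGenerating f)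
    {p : Fin (n + 1) → k} (hp : p ≠ 0) : ∃ i j, C (p i) * f j - C (p j) * f i ≠ 0 := by
  by_contra! h
  obtain ⟨i, v, hv⟩ := exists_eq_C_mul_add (f := f) (g := 0) hp fun i j => zero_dvd_iff.2 (h i j)
  have : Nontrivial (Fin (n + 1)) := Fin.nontrivial_iff_two_le.2 (by omega)
  obtain ⟨j, hj⟩ := exists_ne i
  refine hmin j ?_
  rw [hv j, zero_mul, add_zero]
  exact Ideal.mul_mem_left _ _ (Ideal.mul_mem_left _ _
    (Ideal.subset_span ⟨i, hj.symm, rfl⟩))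

end Main

end

theorem theorem2p5 {k : Type*} [Field k] [IsAlgClosed k] {m n d : ℕ} (hm : 2 ≤ m)
    (f : Fin (n + 1) → MvPolynomial (Fin (m + 1)) k)
    (hhom : ∀ i, (f i).IsHomogeneous d)
    (hmin : IsMinimalGenerating f)
    (hgcd : IsGCDOf (Set.range f) 1)
    (hfin : IsGenericallyFinite f)
    (hJ : minorIdeal 3 (jacobianMatrix f) ≠ ⊥)
    (F : MvPolynomial (Fin (m + 1)) k)
    (hF : IsGCDOf (minorSet 3 (jacobianMatrix f)) F) :
    (fiberDimLocus f (m - 1)).Finite ∧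
    (∀ y ∈ fiberDimLocus f (m - 1), ∃ h : MvPolynomial (Fin (m + 1)) k,
      h ≠ 0 ∧ (∃ e : ℕ, h.IsHomogeneous e) ∧
        unmixedPart (fiberIdealAt f y) = Ideal.span {h}) ∧
    F.totalDegree ≤ 3 * (d - 1) ∧
    ∀ (h : Projectivization k (Fin (n + 1) → k) → MvPolynomial (Fin (m + 1)) k)
      (r : Projectivization k (Fin (n + 1) → k) → ℕ)
      (q : ∀ y, Fin (r y) → MvPolynomial (Fin (m + 1)) k)
      (e : ∀ y, Fin (r y) → ℕ),
      (∀ y ∈ fiberDimLocus f (m - 1), unmixedPart (fiberIdealAt f y) = Ideal.span {h y}) →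
      (∀ y ∈ fiberDimLocus f (m - 1), IsIrreducibleFactorization (h y) (q y) (e y)) →
      (∑ᶠ y ∈ fiberDimLocus f (m - 1), (h y).totalDegree) ≤
          (∑ᶠ y ∈ fiberDimLocus f (m - 1), ∑ i, (2 * e y i - 1) * (q y i).totalDegree) ∧
        (∑ᶠ y ∈ fiberDimLocus f (m - 1), ∑ i, (2 * e y i - 1) * (q y i).totalDegree) ≤
          F.totalDegree := by

  have hmin3 : ∃ s ∈ minorSet 3 (jacobianMatrix f), s ≠ 0 := by
    by_contra! h
    exact hJ (Ideal.span_eq_bot.2 h)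
  obtain ⟨s, hs, hs0⟩ := hmin3
  have hF0 : F ≠ 0 := fun h => hs0 (zero_dvd_iff.1 (h ▸ hF.1 s hs))
  -- A 3-minor exists, so the matrix has at least three rows.
  have hn : 0 < n := by
    obtain ⟨⟨r, -⟩, -⟩ := hs
    have := Fintype.card_le_of_embedding r.toEmbedding
    simp only [Fintype.card_fin] at this
    omega
  have hne := fun y : Projectivization k (Fin (n + 1) → k) =>
    exists_mul_sub_mul_ne_zero hn hmin y.rep_nonzero
  have hunm : ∀ y ∈ fiberDimLocus f (m - 1), ∃ h, h ≠ 0 ∧ ¬ IsUnit h ∧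
      unmixedPart (fiberIdealAt f y) = Ideal.span {h} := by
    intro y hy
    refine exists_unmixedPart_fiberIdeal_eq_span y.rep_nonzero hgcd (hne y)
      (ringKrullDim_quotient_eq_of_projDim (by omega) (fun h0 => ?_) hy)
    obtain ⟨i, j, hij⟩ := hne y
    have h1 : _ ∈ fiberIdealAt f y := mul_sub_mul_mem_fiberIdeal (f := f) y.rep i j
    have h2 : fiberIdealAt f y = ⊥ := h0
    rw [h2] at h1
    exact hij h1
  have hdvd : ∀ (y : Projectivization k (Fin (n + 1) → k)) (h : MvPolynomial (Fin (m + 1)) k),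
      unmixedPart (fiberIdealAt f y) = Ideal.span {h} →
      ∀ i j, h ∣ C (y.rep i) * f j - C (y.rep j) * f i := fun y h hh i j => by
    rw [← Ideal.mem_span_singleton, ← hh]
    exact le_unmixedPart _ (mul_sub_mul_mem_fiberIdeal y.rep i j)
  have hfinite : (fiberDimLocus f (m - 1)).Finite := by
    have hprime : ∀ y : Projectivization k (Fin (n + 1) → k), ∃ q : MvPolynomial (Fin (m + 1)) k,
        y ∈ fiberDimLocus f (m - 1) →
          Prime q ∧ ∀ i j, q ∣ C (y.rep i) * f j - C (y.rep j) * f i := by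
      intro y
      by_cases hy : y ∈ fiberDimLocus f (m - 1)
      · obtain ⟨h, h0, hu, hh⟩ := hunm y hy
        obtain ⟨q, hq, hqh⟩ := WfDvdMonoid.exists_irreducible_factor hu h0
        exact ⟨q, fun _ => ⟨hq.prime, fun i j => hqh.trans (hdvd y h hh i j)⟩⟩
      · exact ⟨0, fun h => absurd h hy⟩
    choose q hq using hprime
    by_contra hinf
    -- Each point contributes a prime of degree at least 1 to the bound, so more than `deg F` points
    -- are impossible.
    obtain ⟨T, hT, hcard⟩ := Set.Infinite.exists_subset_card_eq hinf (F.totalDegree + 1)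
    have h1 := sum_totalDegree_le_of_isGCDOf hgcd hF hF0 T (fun _ => 1) (fun y _ => q y)
      (fun _ _ => 1) (fun y hy _ => (hq y (hT hy)).1)
      (fun y hy i j hij => absurd (Subsingleton.elim i j) hij) (fun _ _ _ => one_pos)
      (fun y hy _ a b => by simpa using (hq y (hT hy)).2 a b)
    have h2 : T.card ≤ F.totalDegree := by
      refine le_trans ?_ h1
      rw [Finset.card_eq_sum_ones]
      refine Finset.sum_le_sum fun y hy => ?_
      simpa using Nat.succ_le_of_lt (totalDegree_pos_of_prime (hq y (hT hy)).1)
    omega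
  refine ⟨hfinite, fun y hy => ?_, ?_, fun h r q e hh hfac => ⟨?_, ?_⟩⟩
  · obtain ⟨h, h0, -, hh⟩ := hunm y hy
    obtain ⟨i, j, hij⟩ := hne y
    refine ⟨h, h0, IsHomogeneous.exists_isHomogeneous_of_dvd (N := d) ?_ hij (hdvd y h hh i j), hh⟩
    exact ((hhom j).C_mul _).sub ((hhom i).C_mul _)
  · exact (totalDegree_le_of_dvd hs0 (hF.1 s hs)).trans
      (isHomogeneous_of_mem_minorSet_three hhom hs).totalDegree_le
  · rw [finsum_mem_eq_finite_toFinset_sum _ hfinite, finsum_mem_eq_finite_toFinset_sum _ hfinite]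
    refine Finset.sum_le_sum fun y hy => ?_
    have hf := hfac y (hfinite.mem_toFinset.1 hy)
    rw [hf.eq_prod]
    refine (totalDegree_finsetProd _ _).trans (Finset.sum_le_sum fun i _ => ?_)
    -- Reduces to `e ≤ 2 * e - 1`, valid since `e ≥ 1`.
    refine (totalDegree_pow _ _).trans (Nat.mul_le_mul_right _ ?_)
    have := hf.exponent_pos i
    omega
  · rw [finsum_mem_eq_finite_toFinset_sum _ hfinite]
    have hmem := fun y (hy : y ∈ hfinite.toFinset) => hfinite.mem_toFinset.1 hy
    refine sum_totalDegree_le_of_isGCDOf hgcd hF hF0 _ r q e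
      (fun y hy i => ((hfac y (hmem y hy)).irreducible i).prime)
      (fun y hy => (hfac y (hmem y hy)).not_associated)
      (fun y hy => (hfac y (hmem y hy)).exponent_pos) fun y hy i a b => ?_
    refine dvd_trans ?_ (hdvd y (h y) (hh y (hmem y hy)) a b)
    rw [(hfac y (hmem y hy)).eq_prod]
    exact Finset.dvd_prod_of_mem (fun i => q y i ^ e y i) (Finset.mem_univ i)
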